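/- Conventions. Let $\mathcal T$ be a triangulated category with suspension $\Sigma$ and let $X\in\mathcal T$. For a class $\mathcal X$ of objects, $\operatorname{add}\mathcal X$ denotes the smallest full subcategory containing $\mathcal X$ that is closed under finite direct sums and direct summands. Put $\operatorname{thick}^0(X)=\operatorname{add}\varnothing$, $\operatorname{thick}^1(X)=\operatorname{add}\{\Sigma^iX\mid i\in\mathbb Z\}$, and, for $n>1$, let $\operatorname{thick}^n(X)$ be $\operatorname{add}$ of the class of cones of morphisms from an object of $\operatorname{thick}^1(X)$ to an object of $\operatorname{thick}^{n-1}(X)$. Put $\operatorname{thick}(X)=\bigcup_{n\ge 0}\operatorname{thick}^n(X)$ and $$\dim\mathcal T=\inf\{n\ge 0\mid \exists X\in\mathcal T\colon \operatorname{thick}^{n+1}(X)=\mathcal T\}\in\mathbb N\cup\{\infty\}.$$ Proposition. Let $\mathcal A$ be an abelian category with a projective generator $P$, that is, $P$ is projective and every object $X$ of $\mathcal A$ admits an epimorphism $P^n\to X$ for some positive integer $n$. Let $\mathcal P\subseteq\mathcal A$ be the full exact subcategory of projective objects, and let $\mathbf D^{\mathrm b}(\mathcal P)$ be its bounded derived category,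 that is, the homotopy category of bounded complexes of projective objects. The inclusion $\mathcal P\to\mathcal A$ induces an exact and fully faithful functor $\mathbf D^{\mathrm b}(\mathcal P)\to\mathbf D^{\mathrm b}(\mathcal A)$ whose essential image is $\operatorname{thick}(P)$, where $P$ is viewed as a complex concentrated in degree zero; so $\mathbf D^{\mathrm b}(\mathcal P)$ is identified with $\operatorname{thick}(P)\subseteq\mathbf D^{\mathrm b}(\mathcal A)$. Moreover: 1. $\mathbf D^{\mathrm b}(\mathcal P)=\mathbf D^{\mathrm b}(\mathcal A)$ (that is, every object of $\mathbf D^{\mathrm b}(\mathcal A)$ lies in the essential image of this functor) if and only if every object of $\mathcal A$ has finite projective dimension. 2. $\dim\mathbf D^{\mathrm b}(\mathcal P)<\infty$ (strong finite generation) if and only if $\operatorname{gl.dim}\mathcal A<\infty$, where $\operatorname{gl.dim}\mathcal A$ is the supremum of the projective dimensions of the objects of $\mathcal A$. -/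

import Mathlib

open CategoryTheory CategoryTheory.Limits CategoryTheory.Pretriangulated
open scoped ZeroObject

universe w v u

namespace StrongGeneration

noncomputable section

/-! ### Dimension of a triangulated category -/

/-- `add S`: the smallest full subcategory containing `S` which is closed under finite direct sums
(including the empty one) and direct summands; in particular it is closed under isomorphisms. -/
inductive addClosure {T : Type u} [Category.{v} T] [HasZeroMorphisms T] [HasBinaryBiproducts T]
    (S : ObjectProperty T) : ObjectProperty T
  | of (X : T) (hX : S X) : addClosure S X
  | zero (X : T) (hX : IsZero X) : addClosure S X
  | biprod (X Y : T) (hX : addClosure S X) (hY : addClosure S Y) : addClosure S (X ⊞ Y)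
  | retract (X Y : T) (r : Retract X Y) (hY : addClosure S Y) : addClosure S X

section Triangulated

variable {T : Type u} [Category.{v} T] [HasZeroObject T] [HasShift T ℤ] [Preadditive T]
  [∀ n : ℤ, (shiftFunctor T n).Additive] [Pretriangulated T]

/-- The shifts `Σ^i X`, for `i : ℤ`. -/
def shifts (X : T) : ObjectProperty T :=
  fun Y => ∃ i : ℤ, Nonempty (Y ≅ (shiftFunctor T i).obj X)

/-- The cones of the morphisms `φ : U ⟶ V` with `U` in `S₁` and `V` in `S₂`. -/
def cones (S₁ S₂ : ObjectProperty T) : ObjectProperty T :=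
  fun Z => ∃ (U V : T) (φ : U ⟶ V) (g : V ⟶ Z) (h : Z ⟶ (shiftFunctor T (1 : ℤ)).obj U),
    S₁ U ∧ S₂ V ∧ Triangle.mk φ g h ∈ distTriang T

/-- The full subcategories `thick^n(X)`. -/
def thickLevel (X : T) : ℕ → ObjectProperty T
  | 0 => addClosure ⊥
  | 1 => addClosure (shifts X)
  | n + 2 => addClosure (cones (addClosure (shifts X)) (thickLevel X (n + 1)))

/-- `thick(X)`, the union of the `thick^n(X)`. -/
def thick (X : T) : ObjectProperty T := fun Y => ∃ n : ℕ, thickLevel X n Y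

variable (T) in
/-- The dimension of a triangulated category: the infimum of the `n ≥ 0` such that
`thick^{n+1}(X)` is everything for some object `X` (so `⊤` if there is no such `n`). -/
def triangDim : ℕ∞ :=
  sInf {d : ℕ∞ | ∃ n : ℕ, d = n ∧ ∃ X : T, thickLevel X (n + 1) = ⊤}

end Triangulated

/-! ### Homological dimension in an abelian category -/

section Abelian

variable (A : Type u) [Category.{v} A] [Abelian A]

/-- A projective generator: a projective object `P` such that every object is a quotient
of a finite direct sum `P^n`. -/
def IsProjectiveGenerator {A : Type u} [Category.{v} A] [Abelian A] (P : A) : Prop :=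
  haveI : HasFiniteBiproducts A := Abelian.hasFiniteBiproducts
  Projective P ∧ ∀ X : A, ∃ n : ℕ, 0 < n ∧ ∃ f : (⨁ fun _ : Fin n => P) ⟶ X, Epi f

/-- The global dimension: the supremum of the projective dimensions of all objects
(the projective dimension of a zero object being `⊥`). -/
def globalDimension : WithBot ℕ∞ := ⨆ X : A, projectiveDimension X

/-! ### The category of projective objects -/

/-- The full subcategory of projective objects. -/
abbrev Proj : Type u := (isProjective A).FullSubcategory

instance : (isProjective A).ContainsZero where
  exists_zero := ⟨_, isZero_zero A, (inferInstance : Projective _)⟩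

instance (J : Type*) :
    (isProjective A).IsClosedUnderColimitsOfShape (Discrete J) where
  colimitsOfShape_le := by
    rintro Y ⟨p⟩
    have hp (j : J) : Projective (p.diag.obj ⟨j⟩) := p.prop_diag_obj _
    exact ⟨fun q e _ => ⟨p.isColimit.desc (Cocone.mk _
      (Discrete.natTrans (fun ⟨j⟩ => (Projective.factorThru (p.ι.app ⟨j⟩ ≫ q) e :)))),
        p.isColimit.hom_ext (fun ⟨j⟩ => by simp [p.isColimit.fac_assoc])⟩⟩

instance : HasBinaryBiproducts (Proj A) :=
  HasBinaryBiproducts.of_hasBinaryCoproducts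

end Abelian

/-! ### Bounded homotopy categories -/

section Homotopy

variable (C : Type u) [Category.{v} C] [Preadditive C]

/-- The bounded complexes, as objects of the homotopy category of cochain complexes. -/
def boundedComplexes : ObjectProperty (HomotopyCategory C (ComplexShape.up ℤ)) :=
  fun K => ∃ a b : ℤ, CochainComplex.IsStrictlyGE K.as a ∧ CochainComplex.IsStrictlyLE K.as b

instance [HasZeroObject C] : (boundedComplexes C).ContainsZero where
  exists_zero :=
    ⟨(HomotopyCategory.quotient _ _).obj 0, Functor.map_isZero _ (isZero_zero _),
      0, 0, inferInstanceAs (CochainComplex.IsStrictlyGE (0 : CochainComplex C ℤ) 0),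
      inferInstanceAs (CochainComplex.IsStrictlyLE (0 : CochainComplex C ℤ) 0)⟩

instance : (boundedComplexes C).IsStableUnderShift ℤ where
  isStableUnderShiftBy n :=
    { le_shift K hK := by
        obtain ⟨K : CochainComplex _ _, rfl⟩ := K.quotient_obj_surjective
        obtain ⟨a, b, ha, hb⟩ := hK
        change CochainComplex.IsStrictlyGE K a at ha
        change CochainComplex.IsStrictlyLE K b at hb
        rw [ObjectProperty.prop_shift_iff, HomotopyCategory.shift_quotient_obj]
        exact ⟨a - n, b - n, K.isStrictlyGE_shift a n (a - n) (by lia),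
          K.isStrictlyLE_shift b n (b - n) (by lia)⟩ }

instance [HasZeroObject C] [HasBinaryBiproducts C] :
    (boundedComplexes C).IsTriangulatedClosed₃ where
  ext₃' T hT h₁ h₂ := by
    obtain ⟨a₁, b₁, ha₁, hb₁⟩ := h₁
    obtain ⟨a₂, b₂, ha₂, hb₂⟩ := h₂
    obtain ⟨f : T.obj₁.as ⟶ T.obj₂.as, hf⟩ :=
      (HomotopyCategory.quotient _ _).map_surjective T.mor₁
    refine ⟨(HomotopyCategory.quotient _ _).obj (CochainComplex.mappingCone f),
      ⟨min (a₁ - 1) a₂, max b₁ b₂, ?_, ?_⟩,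
      ⟨Triangle.π₃.mapIso (isoTriangleOfIso₁₂ T _ hT
        (HomotopyCategory.mappingCone_triangleh_distinguished f)
        (Iso.refl _) (Iso.refl _) (by
          rw [← hf]
          exact (Category.comp_id _).trans (Category.id_comp _).symm))⟩⟩
    · exact CochainComplex.isStrictlyGE_mappingCone f a₁ a₂ _ (by simp) (by simp)
    · change CochainComplex.IsStrictlyLE (CochainComplex.mappingCone f) _
      rw [CochainComplex.isStrictlyLE_iff]
      intro i hi
      rw [CochainComplex.mappingCone.isZero_X_iff]
      rw [max_lt_iff] at hi
      exact ⟨CochainComplex.isZero_of_isStrictlyLE _ b₁ _,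
        CochainComplex.isZero_of_isStrictlyLE _ b₂ _⟩

instance [HasZeroObject C] [HasBinaryBiproducts C] : (boundedComplexes C).IsTriangulated where
  toIsTriangulatedClosed₂ := .of_isTriangulatedClosed₃

/-- The homotopy category `K^b(C)` of bounded complexes. -/
abbrev Kb : Type (max u v) := (boundedComplexes C).FullSubcategory

end Homotopy

/-! ### The bounded derived category of the projective objects -/

section DbProj

variable (A : Type u) [Category.{v} A] [Abelian A]

/-- The bounded derived category of the exact category of projective objects. All conflations
of projective objects split, and direct summands of projective objects are projective, so that
a bounded complex of projective objects is acyclic if and only if it is contractible: nothing has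
to be inverted in the homotopy category of bounded complexes. -/
abbrev DbProj : Type (max u v) := Kb (Proj A)

variable [HasDerivedCategory.{w} A]

/-- The canonical functor from `D^b(Proj A)` to the unbounded derived category of `A`: it sends
a bounded complex of projective objects to itself. -/
abbrev toDerived : DbProj A ⥤ DerivedCategory A :=
  (boundedComplexes (Proj A)).ι ⋙
    (isProjective A).ι.mapHomotopyCategory (ComplexShape.up ℤ) ⋙ DerivedCategory.Qh

lemma bounded_toDerived_obj (K : DbProj A) :
    (DerivedCategory.TStructure.t (C := A)).bounded ((toDerived A).obj K) := by
  obtain ⟨K, a, b, ha, hb⟩ := K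
  obtain ⟨K : CochainComplex _ _, rfl⟩ := K.quotient_obj_surjective
  change CochainComplex.IsStrictlyGE K a at ha
  change CochainComplex.IsStrictlyLE K b at hb
  let L : CochainComplex A ℤ := ((isProjective A).ι.mapHomologicalComplex _).obj K
  have : L.IsStrictlyGE a :=
    inferInstanceAs (CochainComplex.IsStrictlyGE
      (((isProjective A).ι.mapHomologicalComplex _).obj K) a)
  have : L.IsStrictlyLE b :=
    inferInstanceAs (CochainComplex.IsStrictlyLE
      (((isProjective A).ι.mapHomologicalComplex _).obj K) b)
  let e := (DerivedCategory.quotientCompQhIso A).symm.app L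
  exact ⟨⟨a, DerivedCategory.TStructure.t.isGE_of_iso e a⟩,
    ⟨b, DerivedCategory.TStructure.t.isLE_of_iso e b⟩⟩

/-- The canonical functor `D^b(Proj A) ⥤ D^b(A)`, induced by the inclusion `Proj A ⥤ A`. -/
def toDb : DbProj A ⥤ DerivedCategory.Bounded A :=
  (DerivedCategory.TStructure.t (C := A)).bounded.lift (toDerived A) (bounded_toDerived_obj A)

instance : (toDb A).CommShift ℤ := by
  dsimp only [toDb]
  infer_instance

variable {A} in
/-- An object of `A`, viewed in `D^b(A)` as a complex concentrated in degree zero. -/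
def single (X : A) : DerivedCategory.Bounded A :=
  ⟨(DerivedCategory.singleFunctor A 0).obj X, ⟨0, inferInstance⟩, ⟨0, inferInstance⟩⟩

end DbProj

end

end StrongGeneration

/-! Bounded above complexes of projectives are K-projective, so morphisms out of them in the derived
category are homotopy classes of chain maps; hence `toDb` is fully faithful. Its essential image is
the class `projBounded` of those `X` which, for some `a`, have no nonzero morphism to `D^{≤ a-1}`.
This class is thick and contains `P`. Conversely, `exists_triangle` kills the top cohomology of `X`
by a shifted projective; once a single degree is left, orthogonality splits the cover. Counting the
steps gives `essImage_eq_thick`.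

For (1), `Ext^i(X, Y) = Hom(X, Y[i])`, so orthogonality bounds the projective dimension of an object
in the image. Conversely, dimension shifting puts every object of `A` in the image, and induction on
the amplitude reaches all of `D^b(A)`.

For (2), suppose `gl.dim A ≤ d`. A bounded complex of projectives receives a map, epi on all
cohomology, from a finite sum of shifted projectives. The cohomology of the fibre consists of
syzygies, so after `d` steps it is projective and the complex is itself such a sum. Thus
`thick^{d+1}(P)` is everything, whatever the amplitude (`envelope_of_hasProjectiveDimensionLT`).
Conversely, let `thick^n(G)` be everything, with `G` in `thick^{m+1}(P)`. A class in `Ext^i(X, Y)`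
is a composite of `i` successive `P`-ghosts. By the ghost lemma, `m + 1` of these compose to a
`G`-ghost, so for `i ≥ (m + 1) * n` the class vanishes on `thick^n(G)`. Although `X` need not lie in
`thick(P)`, it is approximated by an object of it up to a cone too far to the left to map to `Y[i]`;
so the class is zero. -/

namespace StrongGeneration

/-! ### Additive closures and shifts -/

section AddClosure

variable {T : Type*} [Category* T] [Preadditive T] [HasBinaryBiproducts T]

lemma addClosure.of_iso {S : ObjectProperty T} {X Y : T} (e : X ≅ Y) (hX : addClosure S X) :
    addClosure S Y :=
  .retract _ _ e.symm.retract hX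

instance (S : ObjectProperty T) : (addClosure S).IsStableUnderRetracts where
  of_retract r h := .retract _ _ r h

lemma addClosure_le {S Q : ObjectProperty T} [Q.IsStableUnderRetracts]
    (hS : S ≤ Q) (h0 : ∀ X, IsZero X → Q X) (h2 : ∀ X Y, Q X → Q Y → Q (X ⊞ Y)) :
    addClosure S ≤ Q := by
  intro X hX
  induction hX with
  | of X hX => exact hS _ hX
  | zero X hX => exact h0 _ hX
  | biprod X Y _ _ h₁ h₂ => exact h2 _ _ h₁ h₂
  | retract X Y r _ h => exact Q.prop_of_retract r h

lemma addClosure_map {T' : Type*} [Category* T'] [Preadditive T'] [HasBinaryBiproducts T']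
    (F : T ⥤ T') [F.Additive] {S : ObjectProperty T} {S' : ObjectProperty T'}
    (h : ∀ X, S X → addClosure S' (F.obj X)) {X : T} (hX : addClosure S X) :
    addClosure S' (F.obj X) := by
  induction hX with
  | of X hX => exact h X hX
  | zero X hX => exact .zero _ (F.map_isZero hX)
  | biprod X Y _ _ h₁ h₂ =>
    have := preservesBinaryBiproducts_of_preservesBiproducts F
    exact .of_iso (F.mapBiprod X Y).symm (.biprod _ _ h₁ h₂)
  | retract X Y r _ h => exact .retract _ _ (r.map F) h

end AddClosure

section Shift

variable {T : Type*} [Category* T] [HasShift T ℤ]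

lemma shifts_map {T' : Type*} [Category* T'] [HasShift T' ℤ] (F : T ⥤ T') [F.CommShift ℤ]
    {G X : T} (hX : shifts G X) : shifts (F.obj G) (F.obj X) := by
  obtain ⟨i, ⟨e⟩⟩ := hX
  exact ⟨i, ⟨F.mapIso e ≪≫ (F.commShiftIso i).app G⟩⟩

lemma shifts_shift {G X : T} (hX : shifts G X) (n : ℤ) : shifts G (X⟦n⟧) := by
  obtain ⟨i, ⟨e⟩⟩ := hX
  exact ⟨i + n, ⟨(shiftFunctor T n).mapIso e ≪≫ ((shiftFunctorAdd T i n).app G).symm⟩⟩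

end Shift

/-! ### Levels of a thick subcategory and iterated extensions -/

section Triangulated

variable {T : Type*} [Category* T] [HasZeroObject T] [HasShift T ℤ] [Preadditive T]
  [∀ n : ℤ, (shiftFunctor T n).Additive] [Pretriangulated T]

instance (G : T) : (addClosure (shifts G)).IsStableUnderShift ℤ where
  isStableUnderShiftBy n :=
    { le_shift _ hX := addClosure_map (shiftFunctor T n) (fun _ h ↦ .of _ (shifts_shift h n)) hX }

instance (G : T) : (addClosure (shifts G)).ContainsZero where
  exists_zero := ⟨0, isZero_zero T, .zero _ (isZero_zero T)⟩

/-- The direct summands of the `n`-fold extensions of objects of `add {Σ^i G}`. -/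
def envelope (G : T) (n : ℕ) : ObjectProperty T :=
  ((addClosure (shifts G)).extensionProductIter n).retractClosure

lemma prop_biprod_of_ext (Q : ObjectProperty T) [Q.IsTriangulatedClosed₂]
    [Q.IsClosedUnderIsomorphisms] (X Y : T) (hX : Q X) (hY : Q Y) : Q (X ⊞ Y) :=
  Q.ext_of_isTriangulatedClosed₂ _ (binaryBiproductTriangle_distinguished X Y) hX hY

instance thickLevel_isStableUnderRetracts (G : T) (n : ℕ) :
    (thickLevel G n).IsStableUnderRetracts := by
  match n with
  | 0 | 1 | n + 2 => dsimp only [thickLevel]; infer_instance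

lemma thickLevel_le (Q : ObjectProperty T) [Q.IsTriangulated] [Q.IsStableUnderRetracts]
    {G : T} (hG : Q G) (n : ℕ) : thickLevel G n ≤ Q := by
  have h0 (X : T) (hX : IsZero X) : Q X := Q.prop_of_iso hX.isoZero.symm Q.prop_zero
  have hs : addClosure (shifts G) ≤ Q := by
    refine addClosure_le ?_ h0 (prop_biprod_of_ext Q)
    rintro X ⟨i, ⟨e⟩⟩
    exact Q.prop_of_iso e.symm (Q.le_shift i _ hG)
  induction n with
  | zero => exact addClosure_le bot_le h0 (prop_biprod_of_ext Q)
  | succ n ih =>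
    cases n with
    | zero => exact hs
    | succ n =>
      refine addClosure_le ?_ h0 (prop_biprod_of_ext Q)
      rintro Z ⟨U, V, φ, g, h, hU, hV, hT⟩
      exact Q.ext_of_isTriangulatedClosed₃ _ hT (hs _ hU) (ih _ hV)

lemma thickLevel_map {T' : Type*} [Category* T'] [HasZeroObject T'] [HasShift T' ℤ]
    [Preadditive T'] [∀ n : ℤ, (shiftFunctor T' n).Additive] [Pretriangulated T']
    (F : T ⥤ T') [F.CommShift ℤ] [F.IsTriangulated] (G : T) (n : ℕ) {X : T}
    (hX : thickLevel G n X) : thickLevel (F.obj G) n (F.obj X) := by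
  induction n generalizing X with
  | zero => exact addClosure_map F (fun _ h ↦ h.elim) hX
  | succ n ih =>
    cases n with
    | zero => exact addClosure_map F (fun _ h ↦ .of _ (shifts_map F h)) hX
    | succ n =>
      refine addClosure_map F ?_ hX
      rintro Z ⟨U, V, φ, g, h, hU, hV, hT⟩
      exact .of _ ⟨_, _, _, _, _, addClosure_map F (fun _ h ↦ .of _ (shifts_map F h)) hU,
        ih hV, F.map_distinguished _ hT⟩

lemma addClosure_le_envelope (G : T) (n : ℕ) : addClosure (shifts G) ≤ envelope G n :=
  (ObjectProperty.le_extensionProductIter _ n).trans (ObjectProperty.le_retractClosure _)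

lemma envelope_shift (G : T) (n : ℕ) {X : T} (hX : envelope G n X) (a : ℤ) :
    envelope G n (X⟦a⟧) := by
  obtain ⟨Y, hY, ⟨r⟩⟩ := hX
  exact ⟨_, ((addClosure (shifts G)).extensionProductIter n).le_shift a _ hY, ⟨r.map (shiftFunctor T a)⟩⟩

/-- Summands can be taken after all extensions. The new layer enters on the left here, the side on
which projective covers produce it. -/
lemma envelope_ext (G : T) (n : ℕ) (S : Triangle T) (hS : S ∈ distTriang T)
    (h₁ : addClosure (shifts G) S.obj₁) (h₃ : envelope G n S.obj₃) :
    envelope G (n + 1) S.obj₂ := by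
  have := ObjectProperty.extensionProduct_retractClosure_retractClosure_le
    (addClosure (shifts G)) ((addClosure (shifts G)).extensionProductIter n) S.obj₂
    ⟨_, _, _, _, _, hS, ObjectProperty.le_retractClosure _ _ h₁, h₃⟩
  rwa [← ObjectProperty.extensionProductIter_succ] at this

/-- Extensions are associative by the octahedral axiom, so the single layer can be moved to the
right, where rotation turns the extension into a cone. The index `n` counts extensions, hence `n +
1` layers. -/
lemma envelope_le_thickLevel [IsTriangulated T] (G : T) (n : ℕ) :
    envelope G n ≤ thickLevel G (n + 1) := by
  refine (ObjectProperty.retractClosure_le_iff _ _).2 ?_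
  induction n with
  | zero => exact le_rfl
  | succ n ih =>
    rw [ObjectProperty.extensionProductIter_succ']
    rintro X ⟨V, U, f, g, h, hT, hV, hU⟩
    exact .of _ ⟨_, _, _, _, _, ObjectProperty.le_shift _ (-1 : ℤ) _ hU, ih _ hV,
      inv_rot_of_distTriang _ hT⟩

end Triangulated

/-! ### Ghosts and the ghost lemma -/

section Ghost

variable {T : Type*} [Category* T] [HasShift T ℤ] [Preadditive T]

/-- A morphism is a `G`-ghost if it kills all morphisms from the shifts of `G`. -/
def IsGhost (G : T) {X Y : T} (f : X ⟶ Y) : Prop :=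
  ∀ (i : ℤ) (g : G⟦i⟧ ⟶ X), g ≫ f = 0

/-- The compositions of `n` successive `G`-ghosts. -/
def IsGhostComp (G : T) : ℕ → ∀ {X Y : T}, (X ⟶ Y) → Prop
  | 0, _, _, _ => True
  | n + 1, X, Y, f => ∃ (Z : T) (g : X ⟶ Z) (h : Z ⟶ Y), IsGhostComp G n g ∧ IsGhost G h ∧ g ≫ h = f

variable {G : T}

lemma IsGhost.precomp {X Y Z : T} (f : X ⟶ Y) {g : Y ⟶ Z} (hg : IsGhost G g) :
    IsGhost G (f ≫ g) := fun i k ↦ by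
  rw [← Category.assoc, hg]

lemma IsGhost.postcomp {X Y Z : T} {f : X ⟶ Y} (hf : IsGhost G f) (g : Y ⟶ Z) :
    IsGhost G (f ≫ g) := fun i k ↦ by
  rw [← Category.assoc, hf, zero_comp]

lemma IsGhostComp.precomp {n : ℕ} {X Y Z : T} (f : X ⟶ Y) {g : Y ⟶ Z} (hg : IsGhostComp G n g) :
    IsGhostComp G n (f ≫ g) := by
  induction n generalizing Z with
  | zero => trivial
  | succ n ih =>
    obtain ⟨W, a, b, ha, hb, rfl⟩ := hg
    exact ⟨W, f ≫ a, b, ih ha, hb, Category.assoc _ _ _⟩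

lemma IsGhostComp.postcomp {n : ℕ} {X Y Z : T} {f : X ⟶ Y} (hf : IsGhostComp G n f) (g : Y ⟶ Z) :
    IsGhostComp G n (f ≫ g) := by
  cases n with
  | zero => trivial
  | succ n =>
    obtain ⟨W, a, b, ha, hb, rfl⟩ := hf
    exact ⟨W, a, b ≫ g, ha, hb.postcomp g, (Category.assoc _ _ _).symm⟩

/-- `IsGhostComp` grows at the target, whereas syzygies produce ghosts starting at the source. -/
lemma IsGhost.comp_isGhostComp {n : ℕ} {X Y Z : T} {f : X ⟶ Y} {g : Y ⟶ Z}
    (hf : IsGhost G f) (hg : IsGhostComp G n g) : IsGhostComp G (n + 1) (f ≫ g) := by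
  induction n generalizing Z with
  | zero => exact ⟨X, 𝟙 X, f ≫ g, trivial, hf.postcomp g, Category.id_comp _⟩
  | succ n ih =>
    obtain ⟨W, a, b, ha, hb, rfl⟩ := hg
    exact ⟨W, f ≫ a, b, ih ha, hb, Category.assoc _ _ _⟩

lemma IsGhostComp.of_le {m n : ℕ} (hmn : m ≤ n) {X Y : T} {f : X ⟶ Y} (hf : IsGhostComp G n f) :
    IsGhostComp G m f := by
  induction n, hmn using Nat.le_induction generalizing Y with
  | base => exact hf
  | succ n _ ih =>
    obtain ⟨W, a, b, ha, -, rfl⟩ := hf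
    exact (ih ha).postcomp b

lemma IsGhostComp.exists_of_add {m n : ℕ} {X Y : T} {f : X ⟶ Y} (hf : IsGhostComp G (m + n) f) :
    ∃ (Z : T) (g : X ⟶ Z) (h : Z ⟶ Y), IsGhostComp G m g ∧ IsGhostComp G n h ∧ g ≫ h = f := by
  induction n generalizing Y with
  | zero => exact ⟨Y, f, 𝟙 Y, hf, trivial, Category.comp_id _⟩
  | succ n ih =>
    obtain ⟨W, a, b, ha, hb, rfl⟩ := hf
    obtain ⟨Z, g, h, hg, hh, rfl⟩ := ih ha
    exact ⟨Z, g, h ≫ b, hg, ⟨W, h, b, hh, hb, rfl⟩, (Category.assoc _ _ _).symm⟩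

/-- Change of generator: cut the chain into `n` blocks of length `m`. -/
lemma IsGhostComp.of_mul {G' : T} {m : ℕ}
    (h : ∀ ⦃X Y : T⦄ (f : X ⟶ Y), IsGhostComp G m f → IsGhost G' f)
    {n : ℕ} {X Y : T} {f : X ⟶ Y} (hf : IsGhostComp G (m * n) f) : IsGhostComp G' n f := by
  induction n generalizing Y with
  | zero => trivial
  | succ n ih =>
    obtain ⟨Z, a, b, ha, hb, rfl⟩ := IsGhostComp.exists_of_add hf
    exact ⟨Z, a, b, ih ha, h _ hb, rfl⟩

omit [HasShift T ℤ] in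
lemma eq_zero_of_addClosure [HasBinaryBiproducts T] {S : ObjectProperty T} {W : ∀ ⦃X Y : T⦄, (X ⟶ Y) → Prop}
    (hW : ∀ ⦃X Y Z : T⦄ (f : X ⟶ Y) (g : Y ⟶ Z), W g → W (f ≫ g))
    (hS : ∀ ⦃X Y : T⦄, S X → ∀ f : X ⟶ Y, W f → f = 0)
    {X Y : T} (hX : addClosure S X) (f : X ⟶ Y) (hf : W f) : f = 0 := by
  induction hX with
  | of X hX => exact hS hX f hf
  | zero X hX => exact hX.eq_of_src _ _
  | biprod X₁ X₂ _ _ h₁ h₂ =>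
    ext
    · rw [h₁ _ (hW _ _ hf), comp_zero]
    · rw [h₂ _ (hW _ _ hf), comp_zero]
  | retract X X' r _ h =>
    rw [← Category.id_comp f, ← r.retract, Category.assoc, h _ (hW _ _ hf), comp_zero]

/-- The ghost lemma. -/
lemma IsGhostComp.eq_zero [HasZeroObject T] [∀ n : ℤ, (shiftFunctor T n).Additive]
    [Pretriangulated T] {n : ℕ} {X Y : T} (hX : thickLevel G n X) {f : X ⟶ Y}
    (hf : IsGhostComp G n f) : f = 0 := by
  have hs {X Y : T} (hX : addClosure (shifts G) X) (f : X ⟶ Y) (hf : IsGhost G f) : f = 0 := by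
    refine eq_zero_of_addClosure (W := fun _ _ f ↦ IsGhost G f) (fun _ _ _ f _ hg ↦ hg.precomp f)
      ?_ hX f hf
    rintro X Y ⟨i, ⟨e⟩⟩ f hf
    rw [← cancel_epi e.inv, hf, comp_zero]
  induction n generalizing X Y with
  | zero =>
    exact eq_zero_of_addClosure (W := fun _ _ _ ↦ True) (fun _ _ _ _ _ _ ↦ trivial)
      (fun _ _ h ↦ h.elim) hX f trivial
  | succ n ih =>
    cases n with
    | zero =>
      obtain ⟨Z, a, b, -, hb, rfl⟩ := hf
      exact hs hX _ (hb.precomp a)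
    | succ n =>
      refine eq_zero_of_addClosure (W := fun _ _ f ↦ IsGhostComp G (n + 2) f)
        (fun _ _ _ f _ hg ↦ hg.precomp f) ?_ hX f hf
      rintro Z Y ⟨U, V, φ, g, h, hU, hV, hT⟩ f ⟨W, a, b, ha, hb, rfl⟩
      -- All ghosts but the last vanish on `V`, so they factor through `U⟦1⟧`, which is again in
      -- `add` of the shifts of `G` and is killed by the last one.
      obtain ⟨c, hc⟩ := Triangle.yoneda_exact₃ _ hT a (ih hV (ha.precomp g))
      have hcb : c ≫ b = 0 := hs (ObjectProperty.le_shift _ (1 : ℤ) _ hU) _ (hb.precomp c)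
      rw [hc]
      exact (Category.assoc _ _ _).trans ((congrArg _ hcb).trans comp_zero)

end Ghost

open Triangulated

/-! ### Full faithfulness through K-projectivity -/

section

variable {A : Type u} [Category.{v} A] [Abelian A]

/-- The complex in `A` underlying a complex of projective objects. -/
noncomputable abbrev underlying (K : CochainComplex (Proj A) ℤ) : CochainComplex A ℤ :=
  ((isProjective A).ι.mapHomologicalComplex _).obj K

instance (K : CochainComplex (Proj A) ℤ) (n : ℤ) : Projective ((underlying K).X n) :=
  (K.X n).property

instance (K : CochainComplex (Proj A) ℤ) (b : ℤ) [CochainComplex.IsStrictlyLE K b] :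
    (underlying K).IsStrictlyLE b :=
  inferInstanceAs (CochainComplex.IsStrictlyLE
    (((isProjective A).ι.mapHomologicalComplex _).obj K) b)

instance (K : CochainComplex (Proj A) ℤ) (a : ℤ) [CochainComplex.IsStrictlyGE K a] :
    (underlying K).IsStrictlyGE a :=
  inferInstanceAs (CochainComplex.IsStrictlyGE
    (((isProjective A).ι.mapHomologicalComplex _).obj K) a)

variable [HasDerivedCategory.{w} A]

instance : (toDb A).IsTriangulated := by
  dsimp only [toDb]
  infer_instance

lemma toDerived_map_bijective (K L : DbProj A) :
    Function.Bijective ((toDerived A).map : (K ⟶ L) → _) := by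
  obtain ⟨K, a, b, ha, hb⟩ := K
  obtain ⟨K : CochainComplex _ _, rfl⟩ := K.quotient_obj_surjective
  change CochainComplex.IsStrictlyLE K b at hb
  have : (underlying K).IsKProjective := CochainComplex.isKProjective_of_projective _ b
  have h₁ := CochainComplex.IsKProjective.Qh_map_bijective (underlying K)
    (((isProjective A).ι.mapHomotopyCategory _).obj L.obj)
  have h₂ : Function.Bijective (((isProjective A).ι.mapHomotopyCategory (ComplexShape.up ℤ)).map :
      ((HomotopyCategory.quotient _ _).obj K ⟶ L.obj) → _) :=
    ⟨Functor.map_injective _, Functor.map_surjective _⟩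
  have h₃ : Function.Bijective ((boundedComplexes (Proj A)).ι.map :
      ((⟨(HomotopyCategory.quotient _ _).obj K, a, b, ha, hb⟩ : DbProj A) ⟶ L) → _) :=
    ⟨Functor.map_injective _, Functor.map_surjective _⟩
  exact h₁.comp (h₂.comp h₃)

instance : (toDerived A).Full := ⟨(toDerived_map_bijective _ _).surjective⟩

instance : (toDerived A).Faithful := ⟨fun h ↦ (toDerived_map_bijective _ _).injective h⟩

instance : (toDb A).Full := by
  dsimp only [toDb]
  infer_instance

instance : (toDb A).Faithful := by
  dsimp only [toDb]
  infer_instance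

/-- By K-projectivity the morphism comes from a chain map, and source and target live in disjoint
degrees. -/
lemma Q_hom_eq_zero (K : CochainComplex A ℤ) (a b : ℤ) [K.IsStrictlyGE a] [K.IsStrictlyLE b]
    [∀ i, Projective (K.X i)] (Y : DerivedCategory A) (hY : Y.IsLE (a - 1))
    (f : DerivedCategory.Q.obj K ⟶ Y) : f = 0 := by
  obtain ⟨L, hL, ⟨e⟩⟩ := Y.exists_iso_Q_obj_of_isLE (a - 1)
  have : K.IsKProjective := CochainComplex.isKProjective_of_projective _ b
  rw [← cancel_mono e.hom, zero_comp]
  generalize f ≫ e.hom = g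
  obtain ⟨φ, hφ⟩ := (CochainComplex.IsKProjective.Qh_map_bijective K
    ((HomotopyCategory.quotient _ _).obj L)).surjective
    ((DerivedCategory.quotientCompQhIso A).hom.app K ≫ g ≫
      (DerivedCategory.quotientCompQhIso A).inv.app L)
  obtain ⟨ψ : K ⟶ L, rfl⟩ := (HomotopyCategory.quotient _ _).map_surjective φ
  have hψ : ψ = 0 := by
    ext i
    by_cases hi : i < a
    · exact (K.isZero_of_isStrictlyGE a i hi).eq_of_src _ _
    · exact (L.isZero_of_isStrictlyLE (a - 1) i (by lia)).eq_of_tgt _ _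
  rw [hψ, Functor.map_zero, Functor.map_zero] at hφ
  rw [← cancel_epi ((DerivedCategory.quotientCompQhIso A).hom.app K),
    ← cancel_mono ((DerivedCategory.quotientCompQhIso A).inv.app L), Category.assoc, ← hφ]
  simp

end

/-! ### The t-structure on `D^b(A)`, orthogonality and shifted objects of `A` -/

section

variable {A : Type u} [Category.{v} A] [Abelian A] [HasDerivedCategory.{w} A]

variable (A) in
/-- The canonical t-structure on the bounded derived category. -/
noncomputable abbrev tDb : TStructure (DerivedCategory.Bounded A) :=
  (DerivedCategory.TStructure.t (C := A)).bounded.tStructure DerivedCategory.TStructure.t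

lemma tDb_isLE_iff (X : DerivedCategory.Bounded A) (n : ℤ) :
    (tDb A).IsLE X n ↔ X.obj.IsLE n :=
  ObjectProperty.tStructure_isLE_iff _ _ _ _

lemma tDb_isGE_iff (X : DerivedCategory.Bounded A) (n : ℤ) :
    (tDb A).IsGE X n ↔ X.obj.IsGE n :=
  ObjectProperty.tStructure_isGE_iff _ _ _ _

lemma exists_isGE (X : DerivedCategory.Bounded A) : ∃ a, (tDb A).IsGE X a := by
  simp only [tDb_isGE_iff]
  exact X.property.1

lemma exists_isLE (X : DerivedCategory.Bounded A) : ∃ b, (tDb A).IsLE X b := by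
  simp only [tDb_isLE_iff]
  exact X.property.2

variable (A) in
/-- The cohomology functors on the bounded derived category. -/
noncomputable abbrev cohomology (n : ℤ) : DerivedCategory.Bounded A ⥤ A :=
  DerivedCategory.Bounded.ι ⋙ DerivedCategory.homologyFunctor A n

lemma tDb_isLE_iff_isZero (X : DerivedCategory.Bounded A) (n : ℤ) :
    (tDb A).IsLE X n ↔ ∀ i, n < i → IsZero ((cohomology A i).obj X) := by
  rw [tDb_isLE_iff, DerivedCategory.isLE_iff]; rfl

lemma tDb_isGE_iff_isZero (X : DerivedCategory.Bounded A) (n : ℤ) :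
    (tDb A).IsGE X n ↔ ∀ i, i < n → IsZero ((cohomology A i).obj X) := by
  rw [tDb_isGE_iff, DerivedCategory.isGE_iff]; rfl

variable (A) in
/-- The objects of `D^b(A)` without nonzero morphisms to objects in degrees `< a`. -/
def projGE (a : ℤ) : ObjectProperty (DerivedCategory.Bounded A) :=
  ((tDb A).le (a - 1)).leftOrthogonal

instance (a : ℤ) : (projGE A a).IsTriangulatedClosed₂ := by
  dsimp only [projGE]; infer_instance

instance (a : ℤ) : (projGE A a).IsStableUnderRetracts where
  of_retract r h Y f hY := by
    rw [← Category.id_comp f, ← r.retract, Category.assoc, h (r.r ≫ f) hY, comp_zero]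

lemma projGE_antitone {a a' : ℤ} (h : a ≤ a') : projGE A a' ≤ projGE A a := fun _ hX _ f hY ↦
  hX f ((tDb A).le_monotone (by lia) _ hY)

lemma projGE_shift {a : ℤ} (n : ℤ) {X : DerivedCategory.Bounded A} (hX : projGE A a X) :
    projGE A (a - n) (X⟦n⟧) := fun Y f hY ↦ by
  obtain ⟨g, rfl⟩ := ((shiftEquiv _ n).toAdjunction.homEquiv _ _).symm.surjective f
  have : g = 0 := hX g ((tDb A).le_shift _ _ _ (by lia) _ hY)
  simp only [this, Adjunction.homEquiv_counit, Functor.map_zero, zero_comp]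
  rfl

variable (A) in
/-- The objects of `D^b(A)` which belong to `projGE A a` for some `a`. -/
def projBounded : ObjectProperty (DerivedCategory.Bounded A) := fun X ↦ ∃ a, projGE A a X

instance : (projBounded A).IsStableUnderRetracts where
  of_retract r h := h.imp fun _ ↦ (projGE A _).prop_of_retract r

instance : (projBounded A).IsTriangulated where
  exists_zero := ⟨0, isZero_zero _, 0, fun _ _ _ ↦ (isZero_zero _).eq_of_src _ _⟩
  isStableUnderShiftBy n := ⟨fun _ ⟨a, h⟩ ↦ ⟨a - n, projGE_shift n h⟩⟩
  toIsTriangulatedClosed₂ := .mk' (by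
    rintro T hT ⟨a₁, h₁⟩ ⟨a₃, h₃⟩
    exact ⟨min a₁ a₃, (projGE A _).ext_of_isTriangulatedClosed₂ T hT
      (projGE_antitone (min_le_left _ _) _ h₁) (projGE_antitone (min_le_right _ _) _ h₃)⟩)

lemma projGE_of_iso_Q (X : DerivedCategory.Bounded A) (K : CochainComplex A ℤ)
    (e : X.obj ≅ DerivedCategory.Q.obj K) (a b : ℤ) [K.IsStrictlyGE a] [K.IsStrictlyLE b]
    [∀ i, Projective (K.X i)] : projGE A a X := fun Y f hY ↦ by
  ext
  rw [← cancel_epi e.inv]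
  have := Q_hom_eq_zero K a b Y.obj ((tDb_isLE_iff _ _).1 ⟨hY⟩) (e.inv ≫ f.hom)
  simpa using this

lemma essImage_toDb_le : (toDb A).essImage ≤ projBounded A := by
  rintro X ⟨⟨K, a, b, ha, hb⟩, ⟨e⟩⟩
  obtain ⟨K : CochainComplex _ _, rfl⟩ := K.quotient_obj_surjective
  change CochainComplex.IsStrictlyGE K a at ha
  change CochainComplex.IsStrictlyLE K b at hb
  exact ⟨a, projGE_of_iso_Q X (underlying K) (DerivedCategory.Bounded.ι.mapIso e.symm ≪≫
    (DerivedCategory.quotientCompQhIso A).app (underlying K)) a b⟩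

variable (A) in
/-- The embedding of `A` in `D^b(A)`. -/
noncomputable abbrev singleDb : A ⥤ DerivedCategory.Bounded A :=
  (DerivedCategory.TStructure.t (C := A)).bounded.lift (DerivedCategory.singleFunctor A 0)
    (fun X ↦ (single X).property)

/-- The shifts of the objects of `A` in `D^b(A)` in terms of the functors `singleFunctor A i`. -/
noncomputable def singleDbShiftIso (X : A) (i : ℤ) :
    (((singleDb A).obj X)⟦-i⟧).obj ≅ (DerivedCategory.singleFunctor A i).obj X :=
  (DerivedCategory.Bounded.ι.commShiftIso (-i)).app _ ≪≫
    ((DerivedCategory.singleFunctors A).shiftIso (-i) i 0 (by simp)).app X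

variable (A) in
/-- The embedding of the category of projective objects in `K^b(Proj A)`. -/
noncomputable abbrev singleKb : Proj A ⥤ DbProj A :=
  (boundedComplexes (Proj A)).lift
    (HomologicalComplex.single _ _ 0 ⋙ HomotopyCategory.quotient _ _)
    (fun X ↦ ⟨0, 0,
      inferInstanceAs (CochainComplex.IsStrictlyGE ((HomologicalComplex.single _ _ 0).obj X) 0),
      inferInstanceAs (CochainComplex.IsStrictlyLE ((HomologicalComplex.single _ _ 0).obj X) 0)⟩)

/-- The functors `singleKb` and `singleDb` are compatible. -/
noncomputable def toDbSingleKbIso (X : Proj A) :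
    (toDb A).obj ((singleKb A).obj X) ≅ (singleDb A).obj X.obj :=
  (DerivedCategory.TStructure.t (C := A)).bounded.isoMk
    (DerivedCategory.Qh.mapIso ((HomotopyCategory.quotient _ _).mapIso
        ((HomologicalComplex.singleMapHomologicalComplex (isProjective A).ι
          (ComplexShape.up ℤ) 0).app X)) ≪≫
      (DerivedCategory.quotientCompQhIso A).app _ ≪≫
      ((DerivedCategory.singleFunctorIsoCompQ A 0).app X.obj).symm)

instance : (singleDb A).Additive where
  map_add {X Y f g} := by
    ext
    exact (DerivedCategory.singleFunctor A 0).map_add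

instance : (singleKb A).Additive where
  map_add {X Y f g} := by
    ext
    exact (HomologicalComplex.single _ _ 0 ⋙ HomotopyCategory.quotient _ _).map_add

instance (X : A) (i : ℤ) : (tDb A).IsLE (((singleDb A).obj X)⟦-i⟧) i :=
  (tDb_isLE_iff _ _).2 (DerivedCategory.TStructure.t.isLE_of_iso (singleDbShiftIso X i).symm i)

instance (X : A) (i : ℤ) : (tDb A).IsGE (((singleDb A).obj X)⟦-i⟧) i :=
  (tDb_isGE_iff _ _).2 (DerivedCategory.TStructure.t.isGE_of_iso (singleDbShiftIso X i).symm i)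

lemma projGE_single (X : A) [Projective X] (i : ℤ) :
    projGE A i (((singleDb A).obj X)⟦-i⟧) := by
  have (j : ℤ) : Projective (((HomologicalComplex.single A (ComplexShape.up ℤ) i).obj X).X j) := by
    by_cases h : j = i
    · subst h
      exact Projective.of_iso (HomologicalComplex.singleObjXSelf _ j X).symm inferInstance
    · exact Projective.of_iso
        (HomologicalComplex.isZero_single_obj_X (ComplexShape.up ℤ) i X j h).isoZero.symm
          inferInstance
  exact projGE_of_iso_Q _ ((HomologicalComplex.single A (ComplexShape.up ℤ) i).obj X)
    (singleDbShiftIso X i ≪≫ (DerivedCategory.singleFunctorIsoCompQ A i).app X) i i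

lemma essImage_single (X : A) [hX : Projective X] : (toDb A).essImage ((singleDb A).obj X) :=
  ⟨_, ⟨toDbSingleKbIso ⟨X, hX⟩⟩⟩

/-- The diagram chase of `exists_hom_single`: `h` is naturality of the comparison with the homology
of complexes, `hc` the effect of the chain map on homology. -/
lemma comp_eq_of_comm {C : Type*} [Category* C] {W X₁ X₂ X₃ Y₁ Y₂ Z : C} {w : W ⟶ X₁}
    {a : X₁ ⟶ X₂} {b : X₂ ⟶ X₃} {p : X₁ ⟶ Y₁} {q : X₂ ⟶ Y₂} {c : Y₁ ⟶ Y₂} {s : Y₁ ⟶ Z}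
    {φ : Z ⟶ X₃} {e : Y₂ ≅ X₃} (h : a ≫ q = p ≫ c) (hc : c = s ≫ φ ≫ e.inv)
    (hb : q ≫ e.hom = b) : w ≫ a ≫ b = (w ≫ p ≫ s) ≫ φ := by
  rw [← hb, reassoc_of% h, hc]
  simp

omit [HasDerivedCategory.{w} A] in
-- Projectivity lifts `φ` to the cycles, and a map to the cycles is a chain map from the complex
-- concentrated in degree `i`.
lemma exists_hom_Q (K : CochainComplex A ℤ) (i : ℤ) (X : A) [Projective X]
    (φ : X ⟶ K.homology i) :
    ∃ (f : (HomologicalComplex.single A (ComplexShape.up ℤ) i).obj X ⟶ K),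
      HomologicalComplex.homologyMap f i =
        (HomologicalComplex.singleObjHomologySelfIso (ComplexShape.up ℤ) i X).hom ≫ φ := by
  let ψ : X ⟶ K.cycles i := Projective.factorThru φ (K.homologyπ i)
  refine ⟨HomologicalComplex.mkHomFromSingle (ψ ≫ K.iCycles i) (by simp), ?_⟩
  rw [← cancel_epi (HomologicalComplex.homologyπ _ _),
    HomologicalComplex.homologyπ_naturality,
    HomologicalComplex.homologyπ_singleObjHomologySelfIso_hom_assoc,
    ← Projective.factorThru_comp φ (K.homologyπ i), ← Category.assoc]
  congr 1
  rw [← cancel_mono (K.iCycles i)]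
  simp [ψ, HomologicalComplex.singleObjCyclesSelfIso_hom]

/-- A morphism from a projective object to the cohomology of `X` in degree `i` is induced by a
morphism from a complex concentrated in degree `i`. -/
lemma exists_hom_single (X : DerivedCategory.Bounded A) (i : ℤ) (R : A) [Projective R]
    (φ : R ⟶ (cohomology A i).obj X) :
    ∃ (f : ((singleDb A).obj R)⟦-i⟧ ⟶ X) (e : (cohomology A i).obj (((singleDb A).obj R)⟦-i⟧) ≅ R),
      (cohomology A i).map f = e.hom ≫ φ := by
  let K := DerivedCategory.Q.objPreimage X.obj
  let eK : DerivedCategory.Q.obj K ≅ X.obj := DerivedCategory.Q.objObjPreimageIso X.obj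
  let eH : K.homology i ≅ (DerivedCategory.homologyFunctor A i).obj X.obj :=
    (DerivedCategory.homologyFunctorFactors A i).symm.app K ≪≫
      (DerivedCategory.homologyFunctor A i).mapIso eK
  obtain ⟨f, hf⟩ := exists_hom_Q K i R (φ ≫ eH.inv)
  let e₁ := singleDbShiftIso R i ≪≫ (DerivedCategory.singleFunctorIsoCompQ A i).app R
  refine ⟨ObjectProperty.homMk (e₁.hom ≫ DerivedCategory.Q.map f ≫ eK.hom),
    (DerivedCategory.homologyFunctor A i).mapIso e₁ ≪≫
      (DerivedCategory.homologyFunctorFactors A i).app _ ≪≫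
      HomologicalComplex.singleObjHomologySelfIso (ComplexShape.up ℤ) i R, ?_⟩
  refine ((DerivedCategory.homologyFunctor A i).map_comp _ _).trans
    ((congrArg _ ((DerivedCategory.homologyFunctor A i).map_comp _ _)).trans ?_)
  exact comp_eq_of_comm (DerivedCategory.homologyFunctorFactors_hom_naturality f i) hf
    (show (DerivedCategory.homologyFunctorFactors A i).hom.app K ≫ eH.hom = _ from
      Iso.hom_inv_id_app_assoc _ _ _)

end

/-! ### Projective objects as summands of sums of the generator -/

section

variable {A : Type u} [Category.{v} A] [Abelian A]

instance : (isProjective A).ι.Additive where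

lemma exists_addClosure_lift (P : Proj A) (X : A) (n : ℕ) (g : Fin n → (P.obj ⟶ X)) :
    ∃ (R : Proj A) (_ : addClosure (.singleton P) R) (f : R.obj ⟶ X),
      ∀ j, ∃ l : P.obj ⟶ R.obj, l ≫ f = g j := by
  induction n with
  | zero => exact ⟨0, .zero _ (isZero_zero _), 0, fun j ↦ j.elim0⟩
  | succ n ih =>
    obtain ⟨R, hR, f, hf⟩ := ih (fun j ↦ g j.castSucc)
    let F := (isProjective A).ι
    refine ⟨R ⊞ P, .biprod _ _ hR (.of _ (by simp)),
      F.map biprod.fst ≫ f + F.map biprod.snd ≫ g (Fin.last n), fun j ↦ ?_⟩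
    have h₁ : F.map (biprod.inl : R ⟶ R ⊞ P) ≫ F.map biprod.fst = 𝟙 R.obj := by
      rw [← F.map_comp, biprod.inl_fst, F.map_id]; rfl
    have h₂ : F.map (biprod.inl : R ⟶ R ⊞ P) ≫ F.map biprod.snd = 0 := by
      rw [← F.map_comp, biprod.inl_snd, F.map_zero]
    have h₃ : F.map (biprod.inr : P ⟶ R ⊞ P) ≫ F.map biprod.fst = 0 := by
      rw [← F.map_comp, biprod.inr_fst, F.map_zero]
    have h₄ : F.map (biprod.inr : P ⟶ R ⊞ P) ≫ F.map biprod.snd = 𝟙 P.obj := by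
      rw [← F.map_comp, biprod.inr_snd, F.map_id]; rfl
    induction j using Fin.lastCases with
    | last =>
      refine ⟨F.map biprod.inr, ?_⟩
      rw [Preadditive.comp_add, reassoc_of% h₃, reassoc_of% h₄, zero_comp, zero_add]
      exact Category.id_comp _
    | cast j =>
      obtain ⟨l, hl⟩ := hf j
      refine ⟨l ≫ F.map biprod.inl, ?_⟩
      rw [Category.assoc, Preadditive.comp_add, reassoc_of% h₁, reassoc_of% h₂, zero_comp,
        add_zero]
      exact (congrArg (l ≫ ·) (Category.id_comp f)).trans hl

lemma IsProjectiveGenerator.exists_epi {P : A} (hP : IsProjectiveGenerator P) (X : A) :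
    ∃ (R : Proj A) (_ : addClosure (.singleton ⟨P, hP.1⟩) R) (f : R.obj ⟶ X), Epi f := by
  have : HasFiniteBiproducts A := Abelian.hasFiniteBiproducts
  obtain ⟨n, -, f, hf⟩ := hP.2 X
  obtain ⟨R, hR, g, hg⟩ := exists_addClosure_lift ⟨P, hP.1⟩ X n (fun j ↦ biproduct.ι (fun _ : Fin n ↦ P) j ≫ f)
  choose l hl using hg
  have : biproduct.desc l ≫ g = f := by ext j; simp [hl]
  exact ⟨R, hR, g, epi_of_epi_fac this⟩

/-- A cover of a projective object by a finite sum of copies of `P` splits. -/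
lemma IsProjectiveGenerator.addClosure_proj {P : A} (hP : IsProjectiveGenerator P) (R : Proj A) :
    addClosure (.singleton ⟨P, hP.1⟩) R := by
  obtain ⟨R', hR', f, hf⟩ := hP.exists_epi R.obj
  have : Projective R.obj := R.property
  exact .retract _ _
    { i := ObjectProperty.homMk (Projective.factorThru (𝟙 _) f)
      r := ObjectProperty.homMk f
      retract := by
        ext
        exact Projective.factorThru_comp _ _ } hR'

lemma IsProjectiveGenerator.exists_projective_epi {P : A} (hP : IsProjectiveGenerator P) (X : A) :
    ∃ (R : A) (_ : Projective R) (f : R ⟶ X), Epi f := by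
  obtain ⟨R, -, f, hf⟩ := hP.exists_epi X
  exact ⟨R.obj, R.property, f, hf⟩

variable [HasDerivedCategory.{w} A]

lemma IsProjectiveGenerator.addClosure_singleDb {P : A} (hP : IsProjectiveGenerator P)
    (R : A) [hR : Projective R] (i : ℤ) :
    addClosure (shifts (single P)) (((singleDb A).obj R)⟦i⟧) := by
  refine ObjectProperty.le_shift _ i _ (addClosure_map ((isProjective A).ι ⋙ singleDb A)
    (S := .singleton ⟨P, hP.1⟩) ?_ (hP.addClosure_proj ⟨R, hR⟩))
  rintro X hX
  obtain rfl := (ObjectProperty.singleton_iff _ _).1 hX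
  exact .of _ ⟨0, ⟨((shiftFunctorZero _ ℤ).app _).symm⟩⟩

omit [HasDerivedCategory.{w} A] in
lemma IsProjectiveGenerator.addClosure_singleKb {P : A} (hP : IsProjectiveGenerator P)
    (R : Proj A) (i : ℤ) :
    addClosure (shifts ((singleKb A).obj ⟨P, hP.1⟩)) (((singleKb A).obj R)⟦i⟧) := by
  refine ObjectProperty.le_shift _ i _ (addClosure_map (singleKb A)
    (S := .singleton ⟨P, hP.1⟩) ?_ (hP.addClosure_proj R))
  rintro X hX
  obtain rfl := (ObjectProperty.singleton_iff _ _).1 hX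
  exact .of _ ⟨0, ⟨((shiftFunctorZero _ ℤ).app _).symm⟩⟩

end

/-! ### Cohomology of cones -/

section

variable {A : Type u} [Category.{v} A] [Abelian A] [HasDerivedCategory.{w} A]

lemma isZero_cohomology_obj₃ (T : Triangle (DerivedCategory.Bounded A)) (hT : T ∈ distTriang _)
    (i : ℤ) (h₂ : (cohomology A i).map T.mor₂ = 0)
    (h₁ : IsZero ((cohomology A (i + 1)).obj T.obj₁)) :
    IsZero ((cohomology A i).obj T.obj₃) :=
  (DerivedCategory.HomologySequence.exact₃ _
    (DerivedCategory.Bounded.ι.map_distinguished T hT) i (i + 1) rfl).isZero_of_both_zeros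
      h₂ (h₁.eq_of_tgt _ _)

variable {T : Triangle (DerivedCategory.Bounded A)} (hT : T ∈ distTriang _) {b : ℤ}
include hT

lemma isLE_obj₃ (h₁ : (tDb A).IsLE T.obj₁ b) (h₂ : (tDb A).IsLE T.obj₂ b)
    (hf : Epi ((cohomology A b).map T.mor₁)) : (tDb A).IsLE T.obj₃ (b - 1) := by
  rw [tDb_isLE_iff_isZero] at h₁ h₂ ⊢
  intro i hi
  refine isZero_cohomology_obj₃ T hT i ?_ (h₁ _ (by lia))
  obtain rfl | hi' := (show b ≤ i by lia).eq_or_lt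
  · exact (DerivedCategory.HomologySequence.epi_homologyMap_mor₁_iff _
      (DerivedCategory.Bounded.ι.map_distinguished T hT) b).1 hf
  · exact (h₂ i hi').eq_of_src _ _

lemma isGE_obj₃ (h₁ : (tDb A).IsGE T.obj₁ b) {a : ℤ} (h₂ : (tDb A).IsGE T.obj₂ a)
    (hab : a < b) : (tDb A).IsGE T.obj₃ a := by
  rw [tDb_isGE_iff_isZero] at h₁ h₂ ⊢
  intro i hi
  exact isZero_cohomology_obj₃ T hT i ((h₂ i hi).eq_of_src _ _) (h₁ _ (by lia))

end

/-! ### Killing the top cohomology; the essential image is `thick(P)` -/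

section

variable {A : Type u} [Category.{v} A] [Abelian A] [HasDerivedCategory.{w} A]
  {P : A} (hP : IsProjectiveGenerator P)
include hP

omit hP [Abelian A] [HasDerivedCategory.{w} A] in
lemma epi_of_eq_iso_hom_comp {X Y Z : A} {f : X ⟶ Z} {e : X ≅ Y} {φ : Y ⟶ Z} (h : f = e.hom ≫ φ)
    (hφ : Epi φ) : Epi f := by
  subst h; infer_instance

/-- Cover the top cohomology by a projective and realise the cover by a morphism to `X`. The cone
loses degree `b`; the kernel of the cover only contributes in degree `b - 1`, so lower bounds `a <
b` survive. -/
lemma IsProjectiveGenerator.exists_triangle (X : DerivedCategory.Bounded A) (b : ℤ)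
    (hX : (tDb A).IsLE X b) :
    ∃ (R : A) (_ : Projective R) (C : DerivedCategory.Bounded A)
      (f : ((singleDb A).obj R)⟦-b⟧ ⟶ X) (g : X ⟶ C)
      (h : C ⟶ (((singleDb A).obj R)⟦-b⟧)⟦(1 : ℤ)⟧),
      Triangle.mk f g h ∈ distTriang _ ∧ (tDb A).IsLE C (b - 1) ∧
        ∀ a < b, (tDb A).IsGE X a → (tDb A).IsGE C a := by
  obtain ⟨R, hR, φ, hφ⟩ := hP.exists_projective_epi ((cohomology A b).obj X)
  obtain ⟨f, e, hf⟩ := exists_hom_single X b R φ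
  obtain ⟨C, g, h, hT⟩ := distinguished_cocone_triangle f
  have h₁ : (tDb A).IsLE (((singleDb A).obj R)⟦-b⟧) b := inferInstance
  have h₂ : (tDb A).IsGE (((singleDb A).obj R)⟦-b⟧) b := inferInstance
  refine ⟨R, hR, C, f, g, h, hT, isLE_obj₃ hT h₁ hX ?_,
    fun a ha hX' ↦ isGE_obj₃ hT h₂ hX' ha⟩
  exact epi_of_eq_iso_hom_comp hf hφ

omit hP in
-- Cohomology preserves retracts, so `X` is concentrated in degree `a`, with cohomology a summand of
-- `R`.
lemma exists_projective_iso_of_retract {X : DerivedCategory.Bounded A} {a : ℤ} {R : A}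
    [Projective R] (r : Retract X (((singleDb A).obj R)⟦-a⟧)) :
    ∃ (S : A) (_ : Projective S), Nonempty (X ≅ ((singleDb A).obj S)⟦-a⟧) := by
  have hz (i : ℤ) (hi : IsZero ((cohomology A i).obj (((singleDb A).obj R)⟦-a⟧))) :
      IsZero ((cohomology A i).obj X) := by
    rw [IsZero.iff_id_eq_zero, ← (r.map (cohomology A i)).retract]
    exact (congrArg (· ≫ _) (hi.eq_of_tgt _ 0)).trans zero_comp
  have h₁ : X.obj.IsLE a := (DerivedCategory.isLE_iff _ _).2 fun i hi ↦
    hz i ((tDb_isLE_iff_isZero _ a).1 inferInstance i hi)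
  have h₂ : X.obj.IsGE a := (DerivedCategory.isGE_iff _ _).2 fun i hi ↦
    hz i ((tDb_isGE_iff_isZero _ a).1 inferInstance i hi)
  obtain ⟨S, ⟨e⟩⟩ := X.obj.exists_iso_singleFunctor_obj_of_isGE_of_isLE a
  let H := DerivedCategory.singleFunctorCompHomologyFunctorIso A a
  let eS : S ≅ (cohomology A a).obj X :=
    (H.app S).symm ≪≫ (DerivedCategory.homologyFunctor A a).mapIso e.symm
  let eR : (cohomology A a).obj (((singleDb A).obj R)⟦-a⟧) ≅ R :=
    (DerivedCategory.homologyFunctor A a).mapIso (singleDbShiftIso R a) ≪≫ H.app R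
  have hS : Projective S := by
    have r' : Retract S R := .trans (.ofIso eS) (.trans (r.map _) (.ofIso eR))
    exact projective_iff_hasProjectiveDimensionLT_one.2 (r'.hasProjectiveDimensionLT 1)
  exact ⟨S, hS, ⟨ObjectProperty.isoMk _ (e ≪≫ (singleDbShiftIso S a).symm)⟩⟩

omit hP in
lemma essImage_of_retract {X : DerivedCategory.Bounded A} {a : ℤ} {R : A}
    [Projective R] (r : Retract X (((singleDb A).obj R)⟦-a⟧)) : (toDb A).essImage X := by
  obtain ⟨S, hS, ⟨e⟩⟩ := exists_projective_iso_of_retract r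
  exact ObjectProperty.prop_of_iso _ e.symm (ObjectProperty.le_shift _ (-a) _ (essImage_single S))

/-- Objects of `D^b(A)` of projective amplitude in `[a, a + n]`. -/
lemma IsProjectiveGenerator.essImage_and_envelope (n : ℕ) (X : DerivedCategory.Bounded A)
    (a : ℤ) (ha : projGE A a X) (hX : (tDb A).IsLE X (a + n)) :
    (toDb A).essImage X ∧ envelope (single P) n X := by
  induction n generalizing X with
  | zero =>
    rw [Nat.cast_zero, add_zero] at hX
    obtain ⟨R, hR, C, f, g, h, hT, hC, -⟩ := hP.exists_triangle X a hX
    -- `C` lies in degrees `≤ a - 1`, so orthogonality splits the cover `f`.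
    have hg : g = 0 := ha g hC.le
    obtain ⟨s, hs⟩ := Triangle.coyoneda_exact₂ _ hT (𝟙 X)
      ((Category.id_comp _).trans hg)
    let r : Retract X (((singleDb A).obj R)⟦-a⟧) := ⟨s, f, hs.symm⟩
    exact ⟨essImage_of_retract r,
      addClosure_le_envelope _ _ _ (.retract _ _ r (hP.addClosure_singleDb R (-a)))⟩
  | succ n ih =>
    obtain ⟨R, hR, C, f, g, h, hT, hC, -⟩ := hP.exists_triangle X _ hX
    -- In the rotated triangle, `C` is an extension of the suspended projective, now in degree `a +
    -- n ≥ a`, by `X`.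
    have hC' : projGE A a C := (projGE A a).ext_of_isTriangulatedClosed₂ _ (rot_of_distTriang _ hT)
      ha (projGE_antitone (by push_cast; lia) _ (projGE_shift 1 (projGE_single R _)))
    obtain ⟨h₁, h₂⟩ := ih C hC' (by convert hC using 1; push_cast; ring)
    exact ⟨(toDb A).essImage.ext_of_isTriangulatedClosed₂ _ hT
      (ObjectProperty.le_shift _ _ _ (essImage_single R)) h₁,
      envelope_ext _ _ _ hT (hP.addClosure_singleDb R _) h₂⟩

lemma IsProjectiveGenerator.exists_essImage_and_envelope (X : DerivedCategory.Bounded A)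
    (hX : projBounded A X) : (toDb A).essImage X ∧ ∃ n, envelope (single P) n X := by
  obtain ⟨a, ha⟩ := hX
  obtain ⟨b, hb⟩ := exists_isLE X
  obtain ⟨h₁, h₂⟩ := hP.essImage_and_envelope (b - a).toNat X a ha
    ((tDb A).isLE_of_le X b _ (by lia))
  exact ⟨h₁, _, h₂⟩

lemma IsProjectiveGenerator.essImage_eq_projBounded : (toDb A).essImage = projBounded A :=
  le_antisymm essImage_toDb_le fun X hX ↦ (hP.exists_essImage_and_envelope X hX).1

lemma IsProjectiveGenerator.projBounded_single : projBounded A (single P) :=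
  essImage_toDb_le _ (have := hP.1; essImage_single P)

lemma IsProjectiveGenerator.essImage_eq_thick : (toDb A).essImage = thick (single P) := by
  rw [hP.essImage_eq_projBounded]
  refine le_antisymm (fun X hX ↦ ?_) fun X ⟨n, hX⟩ ↦ ?_
  · obtain ⟨-, n, hn⟩ := hP.exists_essImage_and_envelope X hX
    exact ⟨n + 1, envelope_le_thickLevel _ _ _ hn⟩
  · exact thickLevel_le (projBounded A) hP.projBounded_single n _ hX

end

/-! ### Finite projective dimension and part (1) -/

section

variable {A : Type u} [Category.{v} A] [Abelian A] [HasDerivedCategory.{w} A]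

lemma hasProjectiveDimensionLT_of_forall (X : A) (n : ℕ)
    (h : ∀ (i : ℕ), n ≤ i → ∀ (Y : DerivedCategory.Bounded A), (tDb A).IsLE Y (-i) →
      (tDb A).IsGE Y (-i) → ∀ f : (singleDb A).obj X ⟶ Y, f = 0) :
    HasProjectiveDimensionLT X n := by
  have := HasExt.standard A
  refine (hasProjectiveDimensionLT_iff X n).2 fun i hi Y e ↦ ?_
  ext
  rw [Abelian.Ext.zero_hom]
  have h₁ : (((DerivedCategory.singleFunctor A 0).obj Y)⟦(i : ℤ)⟧).IsLE (-i) :=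
    DerivedCategory.TStructure.t.isLE_shift _ 0 _ _ (by lia)
  have h₂ : (((DerivedCategory.singleFunctor A 0).obj Y)⟦(i : ℤ)⟧).IsGE (-i) :=
    DerivedCategory.TStructure.t.isGE_shift _ 0 _ _ (by lia)
  have := h i hi ⟨((DerivedCategory.singleFunctor A 0).obj Y)⟦(i : ℤ)⟧, ⟨_, h₂⟩, ⟨_, h₁⟩⟩
    ((tDb_isLE_iff _ _).2 h₁) ((tDb_isGE_iff _ _).2 h₂) (ObjectProperty.homMk e.hom)
  exact congrArg InducedCategory.Hom.hom this

/-- `Y[i]` lies in `D^{≤ a-1}` as soon as `i ≥ 1 - a`. -/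
lemma hasProjectiveDimensionLT_of_projGE (X : A) (a : ℤ)
    (h : projGE A a ((singleDb A).obj X)) : HasProjectiveDimensionLT X (1 - a).toNat :=
  hasProjectiveDimensionLT_of_forall X _ fun i hi Y hY _ f ↦
    h f ((tDb A).isLE_of_le Y (-i) (a - 1) (by lia)).le

lemma singleDb_triangle {S : ShortComplex A} (hS : S.ShortExact) :
    ∃ h, Triangle.mk ((singleDb A).map S.f) ((singleDb A).map S.g) h ∈ distTriang _ := by
  let e := (DerivedCategory.Bounded.ι (C := A)).commShiftIso (1 : ℤ)
  have he : (hS.singleδ ≫ e.inv.app ((singleDb A).obj S.X₁)) ≫ e.hom.app _ = hS.singleδ :=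
    (Category.assoc _ _ _).trans ((congrArg _ (e.inv_hom_id_app _)).trans (Category.comp_id _))
  refine ⟨ObjectProperty.homMk (hS.singleδ ≫ e.inv.app ((singleDb A).obj S.X₁)), ?_⟩
  refine isomorphic_distinguished _ hS.singleTriangle_distinguished _ ?_
  exact Triangle.isoMk _ _ (Iso.refl _) (Iso.refl _) (Iso.refl _)
    ((Category.comp_id _).trans (Category.id_comp _).symm)
    ((Category.comp_id _).trans (Category.id_comp _).symm)
    ((congrArg (_ ≫ ·) ((shiftFunctor (DerivedCategory A) (1 : ℤ)).map_id _)).trans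
      ((Category.comp_id _).trans (he.trans (Category.id_comp _).symm)))

end

section

variable {A : Type u} [Category.{v} A] [Abelian A] [HasDerivedCategory.{w} A]
  {P : A} (hP : IsProjectiveGenerator P)
include hP

lemma IsProjectiveGenerator.essImage_singleDb (n : ℕ) (X : A) [HasProjectiveDimensionLT X n] :
    (toDb A).essImage ((singleDb A).obj X) := by
  induction n generalizing X with
  | zero =>
    have := isZero_of_hasProjectiveDimensionLT_zero X
    have : Projective X := Projective.of_iso this.isoZero.symm inferInstance
    exact essImage_single X
  | succ n ih =>
    obtain ⟨R, hR, f, hf⟩ := hP.exists_projective_epi X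
    have hS : (ShortComplex.mk (kernel.ι f) f (kernel.condition f)).ShortExact :=
      { exact := ShortComplex.exact_kernel f }
    -- Syzygies lower the projective dimension only when it is allowed to be positive; the bound `<
    -- 1` means that `X` is already projective.
    cases n with
    | zero =>
      have : Projective X := projective_iff_hasProjectiveDimensionLT_one.2 ‹_›
      exact essImage_single X
    | succ n =>
      have := (hS.hasProjectiveDimensionLT_X₃_iff n hR).1 ‹_›
      obtain ⟨h, hT⟩ := singleDb_triangle hS
      exact (toDb A).essImage.ext_of_isTriangulatedClosed₃ _ hT (ih (kernel f)) (essImage_single R)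

lemma IsProjectiveGenerator.essImage_eq_top
    (h : ∀ X : A, (toDb A).essImage ((singleDb A).obj X)) : (toDb A).essImage = ⊤ := by
  have key (n : ℕ) (X : DerivedCategory.Bounded A) (a : ℤ) (h₁ : (tDb A).IsGE X a)
      (h₂ : (tDb A).IsLE X (a + n)) : (toDb A).essImage X := by
    induction n generalizing X with
    | zero =>
      rw [Nat.cast_zero, add_zero, tDb_isLE_iff] at h₂
      rw [tDb_isGE_iff] at h₁
      obtain ⟨S, ⟨e⟩⟩ := X.obj.exists_iso_singleFunctor_obj_of_isGE_of_isLE a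
      let e' : X ≅ ((singleDb A).obj S)⟦-a⟧ :=
        ObjectProperty.isoMk _ (e ≪≫ (singleDbShiftIso S a).symm)
      exact ObjectProperty.prop_of_iso _ e'.symm (ObjectProperty.le_shift _ _ _ (h S))
    | succ n ih =>
      obtain ⟨R, hR, C, f, g, k, hT, hC, hC'⟩ := hP.exists_triangle X _ h₂
      exact (toDb A).essImage.ext_of_isTriangulatedClosed₂ _ hT
        (ObjectProperty.le_shift _ _ _ (essImage_single R))
        (ih C (hC' a (by push_cast; lia) h₁) (by convert hC using 1; push_cast; ring))
  rw [eq_top_iff]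
  intro X _
  obtain ⟨a, ha⟩ := exists_isGE X
  obtain ⟨b, hb⟩ := exists_isLE X
  exact key (b - a).toNat X a ha ((tDb A).isLE_of_le X b _ (by lia))

lemma IsProjectiveGenerator.essImage_eq_top_iff :
    (toDb A).essImage = ⊤ ↔ ∀ X : A, projectiveDimension X < ⊤ := by
  refine ⟨fun h X ↦ ?_, fun h ↦ hP.essImage_eq_top fun X ↦ ?_⟩
  · obtain ⟨a, ha⟩ := essImage_toDb_le ((singleDb A).obj X) (by rw [h]; trivial)
    rw [lt_top_iff_ne_top, projectiveDimension_ne_top_iff]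
    have := hasProjectiveDimensionLT_of_projGE X a ha
    exact ⟨(1 - a).toNat, hasProjectiveDimensionLT_of_ge X (1 - a).toNat _ (Nat.le_succ _)⟩
  · obtain ⟨n, hn⟩ := (projectiveDimension_ne_top_iff X).1 (h X).ne
    exact hP.essImage_singleDb (n + 1) X

end

/-! ### Finite global dimension gives strong generation -/

/-- Take the direct sum of the `R i` for `i ∈ s`. As `R i` only has cohomology in degree `i`, the
summands do not interact, and `H i` sees only `g i`. It is applied to isomorphisms and to
epimorphisms. -/
lemma exists_addClosure_hom {T A : Type*} [Category* T] [Preadditive T] [HasBinaryBiproducts T]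
    [HasZeroObject T] [Category* A] [Preadditive A] [HasZeroObject A] (H : ℤ → T ⥤ A)
    [∀ i, (H i).Additive] (S : ObjectProperty T) (W : MorphismProperty A) [W.RespectsIso] {K : T}
    (R : ℤ → T) (hR : ∀ i, addClosure S (R i)) (g : ∀ i, R i ⟶ K)
    (hg : ∀ i, W ((H i).map (g i))) (h₀ : ∀ i j, i ≠ j → IsZero ((H j).obj (R i)))
    (h : ∀ i, Projective ((H i).obj (R i))) (s : Finset ℤ) :
    ∃ (Q : T) (f : Q ⟶ K), addClosure S Q ∧ (∀ i ∈ s, W ((H i).map f)) ∧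
      (∀ i ∉ s, IsZero ((H i).obj Q)) ∧ ∀ i, Projective ((H i).obj Q) := by
  have isIso_inl (i : ℤ) (X Y : T) (hY : IsZero ((H i).obj Y)) :
      IsIso ((H i).map (biprod.inl : X ⟶ X ⊞ Y)) :=
    ⟨(H i).map biprod.fst, by rw [← (H i).map_comp, biprod.inl_fst, (H i).map_id], by
      have := congrArg (H i).map (biprod.total (X := X) (Y := Y))
      rwa [Functor.map_add, Functor.map_comp, Functor.map_comp, hY.eq_of_tgt ((H i).map _) 0,
        zero_comp, add_zero, (H i).map_id] at this⟩
  have isIso_inr (i : ℤ) (X Y : T) (hX : IsZero ((H i).obj X)) :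
      IsIso ((H i).map (biprod.inr : Y ⟶ X ⊞ Y)) :=
    ⟨(H i).map biprod.snd, by rw [← (H i).map_comp, biprod.inr_snd, (H i).map_id], by
      have := congrArg (H i).map (biprod.total (X := X) (Y := Y))
      rwa [Functor.map_add, Functor.map_comp, Functor.map_comp,
        hX.eq_of_tgt ((H i).map biprod.fst) 0, zero_comp, zero_add, (H i).map_id] at this⟩
  induction s using Finset.induction_on with
  | empty =>
    have h0 (i : ℤ) : IsZero ((H i).obj 0) := (H i).map_isZero (isZero_zero T)
    exact ⟨0, 0, .zero _ (isZero_zero _), by simp, fun i _ ↦ h0 i,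
      fun i ↦ Projective.of_iso (h0 i).isoZero.symm inferInstance⟩
  | insert j s hj ih =>
    obtain ⟨Q, f, hQ, hf, hQ₀, hQp⟩ := ih
    refine ⟨Q ⊞ R j, biprod.desc f (g j), .biprod _ _ hQ (hR j), ?_, ?_, ?_⟩
    · intro i hi
      obtain rfl | hi' := Finset.mem_insert.1 hi
      · have := isIso_inr i Q (R i) (hQ₀ i hj)
        have h' := hg i
        rwa [← biprod.inr_desc f (g i), Functor.map_comp, W.cancel_left_of_respectsIso] at h'
      · have := isIso_inl i Q (R j) (h₀ _ _ (by rintro rfl; exact hj hi'))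
        have h' := hf i hi'
        rwa [← biprod.inl_desc f (g j), Functor.map_comp, W.cancel_left_of_respectsIso] at h'
    · intro i hi
      rw [Finset.mem_insert, not_or] at hi
      have := isIso_inl i Q (R j) (h₀ _ _ (Ne.symm hi.1))
      exact (hQ₀ i hi.2).of_iso (asIso ((H i).map (biprod.inl : Q ⟶ Q ⊞ R j))).symm
    · intro i
      by_cases hi : i = j
      · subst hi
        have := isIso_inr i Q (R i) (hQ₀ i hj)
        exact Projective.of_iso (asIso ((H i).map (biprod.inr : R i ⟶ Q ⊞ R i))) (h i)
      · have := isIso_inl i Q (R j) (h₀ _ _ (Ne.symm hi))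
        exact Projective.of_iso (asIso ((H i).map (biprod.inl : Q ⟶ Q ⊞ R j))) (hQp i)

section

variable {A : Type u} [Category.{v} A] [Abelian A] [HasDerivedCategory.{w} A]

/-- The functor `toDb` is compatible with the shifts of the projective objects. -/
noncomputable def toDbSingleKbShiftIso (X : Proj A) (i : ℤ) :
    (toDb A).obj (((singleKb A).obj X)⟦i⟧) ≅ ((singleDb A).obj X.obj)⟦i⟧ :=
  ((toDb A).commShiftIso i).app _ ≪≫ (shiftFunctor _ i).mapIso (toDbSingleKbIso X)

lemma isZero_cohomology_single (X : A) (i j : ℤ) (h : i ≠ j) :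
    IsZero ((cohomology A j).obj (((singleDb A).obj X)⟦-i⟧)) := by
  obtain h | h := h.lt_or_gt
  · exact (tDb_isLE_iff_isZero _ i).1 inferInstance j h
  · exact (tDb_isGE_iff_isZero _ i).1 inferInstance j h

/-- The cohomology functors on `D^b(Proj A)`. -/
noncomputable abbrev cohomologyProj (A : Type u) [Category.{v} A] [Abelian A]
    [HasDerivedCategory.{w} A] (i : ℤ) : DbProj A ⥤ A := toDb A ⋙ cohomology A i

lemma projective_cohomology_single (X : A) [Projective X] (i : ℤ) :
    Projective ((cohomology A i).obj (((singleDb A).obj X)⟦-i⟧)) := by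
  obtain ⟨-, e, -⟩ := exists_hom_single (((singleDb A).obj X)⟦-i⟧) i X 0
  exact Projective.of_iso e.symm inferInstance

variable {P : A} (hP : IsProjectiveGenerator P)
include hP

lemma IsProjectiveGenerator.exists_hom_dbProj (K : DbProj A) (W : MorphismProperty A)
    [W.RespectsIso] (hW : ∀ i, ∃ (R : A) (_ : Projective R) (φ : R ⟶ (cohomologyProj A i).obj K), W φ)
    (s : Finset ℤ) :
    ∃ (Q : DbProj A) (f : Q ⟶ K), addClosure (shifts ((singleKb A).obj ⟨P, hP.1⟩)) Q ∧
      (∀ i ∈ s, W ((cohomologyProj A i).map f)) ∧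
      (∀ i ∉ s, IsZero ((cohomologyProj A i).obj Q)) ∧
      ∀ i, Projective ((cohomologyProj A i).obj Q) := by
  choose R hR φ hφ using hW
  choose f e hf using fun i ↦ exists_hom_single ((toDb A).obj K) i (R i) (φ i)
  let e' (i : ℤ) := toDbSingleKbShiftIso (⟨R i, hR i⟩ : Proj A) (-i)
  refine exists_addClosure_hom (cohomologyProj A) _ W
    (fun i ↦ ((singleKb A).obj (⟨R i, hR i⟩ : Proj A))⟦-i⟧) (fun i ↦ hP.addClosure_singleKb _ _)
    (fun i ↦ (toDb A).preimage ((e' i).hom ≫ f i)) (fun i ↦ ?_)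
    (fun i j hij ↦ (isZero_cohomology_single (R i) i j hij).of_iso
      ((cohomology A j).mapIso (e' i)))
    (fun i ↦ Projective.of_iso ((cohomology A i).mapIso (e' i)).symm
      (projective_cohomology_single (R i) i)) s
  change W ((cohomology A i).map ((toDb A).map _))
  rw [Functor.map_preimage, Functor.map_comp, hf, W.cancel_left_of_respectsIso,
    W.cancel_left_of_respectsIso]
  exact hφ i

omit hP in
lemma exists_finset_isZero (K : DbProj A) :
    ∃ s : Finset ℤ, ∀ i ∉ s, IsZero ((cohomologyProj A i).obj K) := by
  obtain ⟨a, ha⟩ := exists_isGE ((toDb A).obj K)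
  obtain ⟨b, hb⟩ := exists_isLE ((toDb A).obj K)
  refine ⟨Finset.Icc a b, fun i hi ↦ ?_⟩
  rw [Finset.mem_Icc, not_and_or, not_le, not_le] at hi
  obtain hi | hi := hi
  · exact (tDb_isGE_iff_isZero _ _).1 ha i hi
  · exact (tDb_isLE_iff_isZero _ _).1 hb i hi

omit hP in
lemma isIso_of_isIso_cohomology {K L : DbProj A} (f : K ⟶ L)
    (h : ∀ i, IsIso ((cohomologyProj A i).map f)) : IsIso f := by
  have : IsIso ((toDerived A).map f) := (DerivedCategory.isIso_iff _ _).2 h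
  exact isIso_of_reflects_iso f (toDerived A)

omit hP in
-- Surjectivity in every degree kills the connecting maps, so the long exact sequence breaks up.
lemma cohomologyProj_shortExact {T : Triangle (DbProj A)} (hT : T ∈ distTriang _)
    (h : ∀ i, Epi ((cohomologyProj A i).map T.mor₂)) (i : ℤ) :
    (ShortComplex.mk ((cohomologyProj A i).map T.mor₁) ((cohomologyProj A i).map T.mor₂)
      (by rw [← Functor.map_comp, comp_distTriang_mor_zero₁₂ _ hT, Functor.map_zero])).ShortExact := by
  have hT' := DerivedCategory.Bounded.ι.map_distinguished _ ((toDb A).map_distinguished T hT)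
  exact
    { exact := DerivedCategory.HomologySequence.exact₂ _ hT' i
      epi_g := h i
      mono_f := (DerivedCategory.HomologySequence.mono_homologyMap_mor₁_iff _ hT' (i - 1) i).2
        ((DerivedCategory.HomologySequence.epi_homologyMap_mor₂_iff _ hT' (i - 1) i).1
          (h (i - 1))) }

/-- Induction on `d` by resolving all cohomology objects simultaneously: the fibre of a
cohomologically epi map from a sum of shifted projectives has the syzygies as cohomology. -/
lemma IsProjectiveGenerator.envelope_of_hasProjectiveDimensionLT (d : ℕ) (K : DbProj A)
    (hK : ∀ i, HasProjectiveDimensionLT ((cohomologyProj A i).obj K) (d + 1)) :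
    envelope ((singleKb A).obj ⟨P, hP.1⟩) d K := by
  obtain ⟨s, hs⟩ := exists_finset_isZero K
  induction d generalizing K s with
  | zero =>
    have hK' (i : ℤ) : Projective ((cohomologyProj A i).obj K) :=
      projective_iff_hasProjectiveDimensionLT_one.2 (hK i)
    -- With projective cohomology, identities serve as covers, so `K` is the sum of its shifted
    -- cohomology objects.
    obtain ⟨Q, f, hQ, hf, hQ₀, -⟩ := hP.exists_hom_dbProj K (.isomorphisms A)
      (fun i ↦ ⟨_, hK' i, 𝟙 _, inferInstanceAs (IsIso (𝟙 ((cohomologyProj A i).obj K)))⟩) s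
    have : IsIso f := isIso_of_isIso_cohomology f fun i ↦ by
      by_cases hi : i ∈ s
      · exact hf i hi
      · exact ⟨0, (hQ₀ i hi).eq_of_src _ _, (hs i hi).eq_of_src _ _⟩
    exact addClosure_le_envelope _ _ _ (.of_iso (asIso f) hQ)
  | succ d ih =>
    obtain ⟨Q, f, hQ, hf, -, hQp⟩ := hP.exists_hom_dbProj K (.epimorphisms A)
      (fun i ↦ hP.exists_projective_epi _) s
    have hf' (i : ℤ) : Epi ((cohomologyProj A i).map f) := by
      by_cases hi : i ∈ s
      · exact hf i hi
      · exact ⟨fun _ _ _ ↦ (hs i hi).eq_of_src _ _⟩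
    obtain ⟨F, u, v, hT⟩ := distinguished_cocone_triangle₁ f
    obtain ⟨s', hs'⟩ := exists_finset_isZero F
    have hF : envelope ((singleKb A).obj ⟨P, hP.1⟩) d F := ih F (fun i ↦
      ((cohomologyProj_shortExact hT hf' i).hasProjectiveDimensionLT_X₃_iff d (hQp i)).1 (hK i))
      s' hs'
    exact envelope_ext _ _ _ (rot_of_distTriang _ hT) hQ (envelope_shift _ _ hF 1)

end

/-! ### Strong generation gives finite global dimension -/

section Ghost

variable {A : Type u} [Category.{v} A] [Abelian A] [HasDerivedCategory.{w} A]
  {P : A} (hP : IsProjectiveGenerator P)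
include hP

/-- The map from `X` to its suspended syzygy is a ghost: shifts of `P` in other degrees have no maps
to `X`, and from degree `a` none to the syzygy. Since `Y` lies far enough to the left, `f` factors
through `n` of these. -/
lemma IsProjectiveGenerator.isGhostComp (n : ℕ) (X Y : DerivedCategory.Bounded A) (a : ℤ)
    (h₁ : (tDb A).IsLE X a) (h₂ : (tDb A).IsGE X a) (hY : (tDb A).IsLE Y (a - n)) (f : X ⟶ Y) :
    IsGhostComp (single P) n f := by
  induction n generalizing X a with
  | zero => trivial
  | succ n ih =>
    obtain ⟨R, hR, C, p, g, k, hT, hC, hC'⟩ := hP.exists_triangle X a h₁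
    have hpf : p ≫ f = 0 := projGE_single R a (p ≫ f)
      ((tDb A).isLE_of_le Y (a - (n + 1 : ℕ)) (a - 1) (by push_cast; lia)).le
    obtain ⟨f', hf'⟩ := Triangle.yoneda_exact₂ _ hT f hpf
    have hCa := hC' (a - 1) (by lia) ((tDb A).isGE_of_ge X (a - 1) a (by lia))
    have hg : IsGhost (single P) g := fun i c ↦ by
      obtain ⟨i, rfl⟩ : ∃ j, i = -j := ⟨-i, by simp⟩
      have := hP.1
      obtain hi | rfl | hi := lt_trichotomy i a
      · have hc : c = 0 := (tDb A).zero_of_isLE_of_isGE c i a hi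
          (inferInstanceAs ((tDb A).IsLE (((singleDb A).obj P)⟦-i⟧) i)) h₂
        rw [hc, zero_comp]
      · exact projGE_single P i (c ≫ g) hC.le
      · have hc : c = 0 := projGE_single P i c ((tDb A).isLE_of_le X a _ (by lia)).le
        rw [hc, zero_comp]
    rw [hf']
    exact hg.comp_isGhostComp (ih C (a - 1) hC hCa (by convert hY using 1; push_cast; ring) f')

/-- This plays the role of a truncated projective resolution: `X` agrees with an object of the image
up to a cone arbitrarily far to the left. -/
lemma IsProjectiveGenerator.extensionProduct_essImage (n : ℕ) (X : DerivedCategory.Bounded A)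
    (b : ℤ) (hX : (tDb A).IsLE X b) :
    ObjectProperty.extensionProduct (toDb A).essImage ((tDb A).le (b - n)) X := by
  induction n generalizing X b with
  | zero => exact ObjectProperty.le_extensionProduct_right _ _ (by simpa using hX)
  | succ n ih =>
    obtain ⟨R, hR, C, p, g, k, hT, hC, -⟩ := hP.exists_triangle X b hX
    have := ih C _ hC
    have hX' : ObjectProperty.extensionProduct (toDb A).essImage
        (ObjectProperty.extensionProduct (toDb A).essImage ((tDb A).le (b - 1 - n))) X :=
      ⟨_, _, _, _, _, hT, ObjectProperty.le_shift _ _ _ (essImage_single R), this⟩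
    rw [← ObjectProperty.extensionProduct_assoc] at hX'
    have e : b - 1 - n = b - (n + 1 : ℕ) := by push_cast; ring
    rw [e] at hX'
    exact ObjectProperty.monotone_extensionProduct_left _
      (ObjectProperty.extensionProduct_le_of_isTriangulatedClosed₂ le_rfl le_rfl) _ hX'

lemma IsProjectiveGenerator.exists_hasProjectiveDimensionLT {G : DbProj A} {n : ℕ}
    (hG : thickLevel G n = ⊤) : ∃ d, ∀ X : A, HasProjectiveDimensionLT X d := by
  obtain ⟨m, hm⟩ := (hP.exists_essImage_and_envelope ((toDb A).obj G)
    (essImage_toDb_le _ ((toDb A).obj_mem_essImage G))).2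
  -- `G` has `m + 1` layers over `P`, and every object has `n` layers over `G`.
  refine ⟨(m + 1) * n, fun X ↦ hasProjectiveDimensionLT_of_forall X _ fun i hi Y hY hY' f ↦ ?_⟩
  have hX : (tDb A).IsLE ((singleDb A).obj X) 0 :=
    (tDb_isLE_iff _ _).2 (inferInstanceAs (((DerivedCategory.singleFunctor A 0).obj X).IsLE 0))
  have hX' : (tDb A).IsGE ((singleDb A).obj X) 0 :=
    (tDb_isGE_iff _ _).2 (inferInstanceAs (((DerivedCategory.singleFunctor A 0).obj X).IsGE 0))
  have hf : IsGhostComp ((toDb A).obj G) n f := by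
    refine IsGhostComp.of_mul (G := single P) (m := m + 1) (fun Z Z' g hg j c ↦ ?_)
      (.of_le hi (hP.isGhostComp i _ Y 0 hX hX' (by simpa using hY) f))
    exact (hg.precomp c).eq_zero (envelope_le_thickLevel _ _ _ (envelope_shift _ _ hm j))
  -- The length `i + 1` puts `C` in degrees `≤ -i - 1`, strictly below `Y`.
  obtain ⟨F, C, p, g, k, hT, ⟨F', ⟨e⟩⟩, hC⟩ := hP.extensionProduct_essImage (i + 1) _ 0 hX
  have hF : thickLevel ((toDb A).obj G) n F :=
    ObjectProperty.prop_of_iso _ e (thickLevel_map (toDb A) G n (by rw [hG]; trivial))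
  obtain ⟨f', rfl⟩ := Triangle.yoneda_exact₂ _ hT f ((hf.precomp p).eq_zero hF)
  have hf' : f' = 0 := (tDb A).zero_of_isLE_of_isGE f' _ (-i) (by push_cast; lia) ⟨hC⟩ hY'
  subst hf'
  exact comp_zero

end Ghost

/-! ### Finiteness of the two dimensions and conclusion -/

lemma triangDim_lt_top_iff {T : Type*} [Category* T] [HasZeroObject T] [HasShift T ℤ]
    [Preadditive T] [∀ n : ℤ, (shiftFunctor T n).Additive] [Pretriangulated T] :
    triangDim T < ⊤ ↔ ∃ (n : ℕ) (X : T), thickLevel X (n + 1) = ⊤ := by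
  rw [triangDim, sInf_lt_iff]
  constructor
  · rintro ⟨_, ⟨n, -, X, hX⟩, -⟩
    exact ⟨n, X, hX⟩
  · rintro ⟨n, X, hX⟩
    exact ⟨n, ⟨n, rfl, X, hX⟩, ENat.natCast_lt_top n⟩

lemma globalDimension_lt_top_iff {A : Type u} [Category.{v} A] [Abelian A] :
    globalDimension A < ⊤ ↔ ∃ d : ℕ, ∀ X : A, HasProjectiveDimensionLT X (d + 1) := by
  simp only [← projectiveDimension_le_iff]
  constructor
  · intro h
    have hle (X : A) : projectiveDimension X ≤ globalDimension A := le_iSup projectiveDimension X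
    generalize globalDimension A = N at h hle
    induction N with
    -- The supremum is `⊥` when every object is zero; any `d` then works.
    | bot => exact ⟨0, fun X ↦ (hle X).trans bot_le⟩
    | coe N =>
      induction N with
      | top => exact (lt_irrefl _ h).elim
      | coe d => exact ⟨d, hle⟩
  · rintro ⟨d, hd⟩
    exact (iSup_le hd).trans_lt (WithBot.coe_lt_coe.2 (ENat.natCast_lt_top d))

section

variable {A : Type u} [Category.{v} A] [Abelian A] [HasDerivedCategory.{w} A]

lemma IsProjectiveGenerator.triangDim_lt_top_iff {P : A} (hP : IsProjectiveGenerator P) :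
    triangDim (DbProj A) < ⊤ ↔ globalDimension A < ⊤ := by
  rw [StrongGeneration.triangDim_lt_top_iff, globalDimension_lt_top_iff]
  constructor
  · rintro ⟨n, G, hG⟩
    obtain ⟨d, hd⟩ := hP.exists_hasProjectiveDimensionLT hG
    exact ⟨d, fun X ↦ have := hd X; hasProjectiveDimensionLT_of_ge X d _ (Nat.le_succ d)⟩
  · rintro ⟨d, hd⟩
    exact ⟨d, _, eq_top_iff.2 fun K _ ↦ envelope_le_thickLevel _ _ _
      (hP.envelope_of_hasProjectiveDimensionLT d K fun i ↦ hd _)⟩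

end

end StrongGeneration

theorem mainTheorem2 {A : Type u} [Category.{v} A] [Abelian A] [HasDerivedCategory.{w} A]
    (P : A) (hP : StrongGeneration.IsProjectiveGenerator P) :
    -- `D^b(Proj A)` is identified with `thick(P)` by the canonical functor to `D^b(A)`
    ((StrongGeneration.toDb A).IsTriangulated ∧ (StrongGeneration.toDb A).Full ∧
      (StrongGeneration.toDb A).Faithful ∧
      (StrongGeneration.toDb A).essImage =
        StrongGeneration.thick (StrongGeneration.single P)) ∧
    -- (1) `D^b(Proj A) = D^b(A)` if and only if all projective dimensions are finite
    ((StrongGeneration.toDb A).essImage = ⊤ ↔ ∀ X : A, projectiveDimension X < ⊤) ∧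
    -- (2) `dim D^b(Proj A) < ∞` if and only if `gl.dim A < ∞`
    (StrongGeneration.triangDim (StrongGeneration.DbProj A) < ⊤ ↔
      StrongGeneration.globalDimension A < ⊤) :=
  ⟨⟨inferInstance, inferInstance, inferInstance, hP.essImage_eq_thick⟩,
    hP.essImage_eq_top_iff, hP.triangDim_lt_top_iff⟩
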